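/- Let $\mathbf k$ be an algebraically closed field of characteristic $0$, let $\mathcal O$ be the set of isomorphism classes of ordered (planar rooted) trees, $\mathbf k\{\mathcal O\}$ the vector space with basis $\mathcal O$, and $\mathbf k\{\mathcal F\}=T(\mathbf k\{\mathcal O\})$ the free algebra on $\mathcal O$, whose basis consists of the words (ordered forests) $\tau_1\cdots\tau_m$. Let $\Delta$ be the coshuffle coproduct, i.e. the algebra map with $\Delta(\tau)=\tau\otimes1+1\otimes\tau$ for $\tau\in\mathcal O$, and $\varepsilon$ its counit; Sweedler notation $X_1\otimes X_2\otimes\cdots$ refers to the iterated coproducts of $X$. Left grafting is the bilinear operation on $\mathbf k\{\mathcal O\}$ with $\tau\curvearrowright\omega=\sum_{s}\tau\circ_s\omega$ for $\tau,\omega\in\mathcal O$, where $s$ runs over the nodes of $\omega$ and $\tau\circ_s\omega$ is obtained by attaching the root of $\tau$ to $s$ to the left of all children of $s$. It extends to a bilinear product $\rhd$ on $\mathbf k\{\mathcal F\}$ by $1\rhd a=a$, $x\rhd a=x\curvearrowright a$, $$(x x_1\cdots x_n)\rhd a=x\rhd\big((x_1\cdots x_n)\rhd a\big)-\sum_{i=1}^n\big(x_1\cdots(x\rhd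 x_i)\cdots x_n\big)\rhd a$$ for $x,x_i,a\in\mathbf k\{\mathcal O\}$, and $X\rhd1=\varepsilon(X)1$, $X\rhd(a_1\cdots a_r)=(X_1\rhd a_1)\cdots(X_r\rhd a_r)$. Let $\alpha:\mathbf k\{\mathcal F\}\to\mathrm{End}(\mathbf k\{\mathcal F\})$, $\alpha_XY=X\rhd Y$, let $\beta$ be the inverse of $\alpha$ for the convolution product, i.e. $\alpha_{X_1}\circ\beta_{X_2}=\beta_{X_1}\circ\alpha_{X_2}=\varepsilon(X)\,\mathrm{id}$, and define $\blacktriangleleft$ bilinearly by $X\blacktriangleleft Y=(-1)^{|X|}\beta_XY$ for words $X$ with $|X|$ letters. For letters $x_1,\dots,x_m\in\mathbf k\{\mathcal O\}$, $Y\in\mathbf k\{\mathcal F\}$ and $w\in S_m$, let $[x_1,\dots,x_m;Y]_w$ be the element obtained from the series $x_{w(1)},\dots,x_{w(m)},Y$ by carrying out the following for $j=1,\dots,m$ successively: replace the entry $u$ involving $x_j$ and its right neighbour $v$ by the single entry $u\rhd v$. Then for all ordered trees $\tau_1,\dots,\tau_m,\omega\in\mathcal O$, $$\tau_1\cdots\tau_m\blacktriangleleft\omega=\sum_{w\in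 S_m}[\tau_1,\dots,\tau_m;\omega]_w ,$$ and this element is equal to the sum, over all left graftings of the scions $\tau_1,\dots,\tau_m$ onto the rootstock $\omega$, of the resulting ordered tree. Here a left grafting is a choice, for each $i$, of a node of $\omega$ or of some $\tau_j$ to which the root of $\tau_i$ is attached, such that all the scions end up, directly or through other scions, on $\omega$ (i.e. the result is a single tree with the root of $\omega$ as its root). In the resulting tree the scions attached to a node stand to the left of the original children of that node, and $\tau_i$ stands to the left of $\tau_j$ whenever $i>j$ and both are attached to the same node. -/

import Mathlib

open scoped TensorProduct

/-- Isomorphism classes of ordered (planar rooted) trees: a tree is a root together with the list,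
read from left to right, of the subtrees hanging from it. -/
inductive OTree : Type
  | node : List OTree → OTree

namespace OTree

/- The nodes of a tree, as addresses: the root is `[]`, and `i :: s` is the node `s` of the `i`-th
subtree (counted from `0`, left to right) below the root. -/
mutual

/-- The set of nodes of an ordered tree. -/
def nodes : OTree → Finset (List ℕ)
  | node cs => insert [] (nodesFrom 0 cs)

/-- The addresses of the nodes in a list of subtrees, the first of which has position `i`. -/
def nodesFrom : ℕ → List OTree → Finset (List ℕ)
  | _, [] => ∅
  | i, c :: cs => (nodes c).image (fun s => i :: s) ∪ nodesFrom (i + 1) cs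

end

/- Attaching, at every node `s`, the roots of the trees of the list `g s` to `s`, in the order of
the list, to the left of all the children that `s` already has. -/
mutual

/-- The tree obtained by attaching, for every node `s`, the trees `g s` to `s` from the left. -/
def attach : (List ℕ → List OTree) → OTree → OTree
  | g, node cs => node (g [] ++ attachFrom g 0 cs)

/-- `attach` on a list of subtrees, the first of which has position `i`. -/
def attachFrom : (List ℕ → List OTree) → ℕ → List OTree → List OTree
  | _, _, [] => []
  | g, i, c :: cs => attach (fun s => g (i :: s)) c :: attachFrom g (i + 1) cs

end

/-- `τ ∘ₛ ω`: the root of `τ` is attached to the node `s` of `ω` from the left. -/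
def graftAt (τ : OTree) (s : List ℕ) (ω : OTree) : OTree :=
  attach (fun p => if p = s then [τ] else []) ω

end OTree

/-- The algebra `k{F}` of ordered forests: the free algebra on the set of ordered trees, i.e. the
tensor algebra of the free module `k{O}`; the forest `τ₁ ⋯ τₘ` is the word `τ₁ ⋯ τₘ`. -/
abbrev ForestAlg (k : Type*) [CommRing k] : Type _ := FreeAlgebra k OTree

noncomputable section

namespace ForestAlg

variable (k : Type*) [CommRing k]

/-- The coshuffle coproduct: the algebra map with `Δ τ = τ ⊗ 1 + 1 ⊗ τ` for every tree `τ`. -/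
def coshuffle : ForestAlg k →ₐ[k] ForestAlg k ⊗[k] ForestAlg k :=
  FreeAlgebra.lift k fun τ => FreeAlgebra.ι k τ ⊗ₜ[k] 1 + 1 ⊗ₜ[k] FreeAlgebra.ι k τ

/-- The counit: the algebra map that kills every tree. -/
def eps : ForestAlg k →ₐ[k] k := FreeAlgebra.lift k fun _ => 0

/-- The coshuffle bialgebra of ordered forests. -/
instance instBialgebra : Bialgebra k (ForestAlg k) :=
  Bialgebra.ofAlgHom (coshuffle k) (eps k)
    (by
      ext τ
      simp [coshuffle, TensorProduct.add_tmul, TensorProduct.tmul_add, Algebra.TensorProduct.one_def]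
      abel)
    (by
      ext τ
      simp [coshuffle, eps])
    (by
      ext τ
      simp [coshuffle, eps])

/-- The inclusion of `k{O}` in `k{F}`. -/
def letters : (OTree →₀ k) →ₗ[k] ForestAlg k :=
  Finsupp.linearCombination k (FreeAlgebra.ι k)

/-- The left grafting operator on `k{O}`: the bilinear map that sends the trees `τ`, `ω` to the sum
of `τ ∘ₛ ω` over all nodes `s` of `ω`. -/
def leftGraft : (OTree →₀ k) →ₗ[k] (OTree →₀ k) →ₗ[k] (OTree →₀ k) :=
  Finsupp.linearCombination k fun τ => Finsupp.linearCombination k fun ω =>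
    ∑ s ∈ ω.nodes, Finsupp.single (OTree.graftAt τ s ω) 1

/-- The extended product `X ▷ a` of a word `X` of trees with a single tree `a`:
`1 ▷ a = a`, and `(x x₁ ⋯ xₙ) ▷ a` is
`x ▷ ((x₁ ⋯ xₙ) ▷ a) - ∑ᵢ (x₁ ⋯ (x ▷ xᵢ) ⋯ xₙ) ▷ a`, where `x ▷ xᵢ` is the left grafting,
here expanded as the sum of `x ∘ₛ xᵢ` over the nodes `s` of `xᵢ`. -/
def wordTri : List OTree → OTree → (OTree →₀ k)
  | [], a => Finsupp.single a 1
  | x :: xs, a =>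
      leftGraft k (Finsupp.single x 1) (wordTri xs a) -
        ∑ i : Fin xs.length, ∑ s ∈ (xs.get i).nodes,
          wordTri (xs.set i (OTree.graftAt x s (xs.get i))) a
termination_by X => X.length
decreasing_by all_goals simp

/-- The linear map `X ↦ X ▷ a`, for a single tree `a`. -/
def triLetter (a : OTree) : ForestAlg k →ₗ[k] ForestAlg k :=
  (FreeAlgebra.basisFreeMonoid k OTree).constr k fun X => letters k (wordTri k X.toList a)

/-- The map `Y ↦ (X ↦ X ▷ Y)`. It sends `a₁ ⋯ aₘ` to the convolution product of the maps
`X ↦ X ▷ aᵢ`, i.e. `X ▷ (a₁ ⋯ aₘ) = (X₁ ▷ a₁) ⋯ (Xₘ ▷ aₘ)` in Sweedler notation for the coshuffle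
coproduct; in particular `X ▷ 1 = ε(X) 1`. -/
def triRight : ForestAlg k →ₐ[k] WithConv (ForestAlg k →ₗ[k] ForestAlg k) :=
  FreeAlgebra.lift k fun a => WithConv.toConv (triLetter k a)

/-- The product `▷` on `k{F}` extending left grafting; as a map to `End (k{F})` it is the left
multiplication `α`, `α_X Y = X ▷ Y`. -/
def tri : ForestAlg k →ₗ[k] Module.End k (ForestAlg k) :=
  LinearMap.flip
    ((WithConv.linearEquiv k (ForestAlg k →ₗ[k] ForestAlg k)).toLinearMap ∘ₗ
      (triRight k).toLinearMap)

/-- The inverse `β` of `α` for the convolution product on `Hom (k{F}, End (k{F}))`. -/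
def beta : ForestAlg k →ₗ[k] Module.End k (ForestAlg k) :=
  (Ring.inverse (WithConv.toConv (tri k))).ofConv

/-- The twisted product `X ◀ Y = (-1)^|X| β_X Y` for words `X` with `|X|` letters, extended
linearly. -/
def btr : ForestAlg k →ₗ[k] Module.End k (ForestAlg k) :=
  (FreeAlgebra.basisFreeMonoid k OTree).constr k fun X =>
    (-1 : k) ^ X.length • beta k (FreeAlgebra.basisFreeMonoid k OTree X)

variable {k}

/-- One step of the nesting procedure, on a series of elements each of which carries the set of
indices `i` of the letters `xᵢ` that it involves: the element involving `x_j` is merged with its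
right neighbour by `▷`. -/
def mergeStep {m : ℕ} (j : Fin m) :
    List (Finset (Fin m) × ForestAlg k) → List (Finset (Fin m) × ForestAlg k)
  | (I, x) :: (J, y) :: rest =>
      if j ∈ I then (I ∪ J, tri k x y) :: rest else (I, x) :: mergeStep j ((J, y) :: rest)
  | l => l

/-- The element `[x₁, …, xₘ; Y]_w`: start with the series `x_{w(1)}, …, x_{w(m)}, Y`, and, for
`j = 1, …, m` in this order, merge the element involving `x_j` with its right neighbour. -/
def nest {m : ℕ} (x : Fin m → ForestAlg k) (Y : ForestAlg k) (w : Equiv.Perm (Fin m)) :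
    ForestAlg k :=
  ((List.finRange m).foldl (fun l j => mergeStep j l)
    ((List.ofFn fun p => (({w p} : Finset (Fin m)), x (w p))) ++ [(∅, Y)])).headD (∅, 0) |>.2

end ForestAlg

end

/-- The trees that take part in a grafting: the rootstock `ω` (index `none`) and the scions
`τ i` (index `some i`). -/
def stock {m : ℕ} (τ : Fin m → OTree) (ω : OTree) : Option (Fin m) → OTree
  | none => ω
  | some i => τ i

/-- A choice, for every scion, of the node to which its root is going to be attached: a node of the
rootstock or of one of the scions. -/
abbrev Attachment {m : ℕ} (τ : Fin m → OTree) (ω : OTree) : Type :=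
  Fin m → (h : Option (Fin m)) × {s : List ℕ // s ∈ (stock τ ω h).nodes}

namespace Attachment

variable {m : ℕ} {τ : Fin m → OTree} {ω : OTree}

/-- The tree to which a scion is attached (with value `none` at the rootstock). -/
def host (f : Attachment τ ω) (h : Option (Fin m)) : Option (Fin m) :=
  h.bind fun i => (f i).1

/-- The attachments produce one tree with rootstock `ω`: from every scion one arrives at the
rootstock by passing from a scion to the tree to which it is attached, again and again. -/
def IsGrafting (f : Attachment τ ω) : Prop :=
  ∀ i : Fin m, ∃ n : ℕ, f.host^[n] (some i) = none

/-- The scions that are attached to the node `s` of the tree with index `h`, listed from left to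
right: a scion with larger index is to the left of one with smaller index. -/
def scionsAt (f : Attachment τ ω) (h : Option (Fin m)) (s : List ℕ) : List (Fin m) :=
  (List.finRange m).reverse.filter fun i => (f i).1 = h ∧ (f i).2.1 = s

/-- The tree with index `h` after all scions that sit on it, directly or through at most `n - 1`
other scions, have been attached. -/
def assemble (f : Attachment τ ω) : ℕ → Option (Fin m) → OTree
  | 0, h => stock τ ω h
  | n + 1, h =>
      OTree.attach (fun s => (f.scionsAt h s).map fun i => f.assemble n (some i)) (stock τ ω h)

/-- The ordered tree that results from a grafting. No chain of scions sitting on one another is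
longer than the number `m` of scions, so that `m` rounds of attaching exhaust all of them. -/
def result (f : Attachment τ ω) : OTree := f.assemble m none

end Attachment

-- All three expressions satisfy one recursion, which eliminates the first letter: `x₁⋯xₘ ◀ Y =
-- x₂⋯xₘ ◀ (x₁ ▷ Y) + ∑ᵢ x₂⋯(x₁ ▷ xᵢ)⋯xₘ ◀ Y`, with `1 ◀ Y = Y`.
--
-- For `◀` it comes from the primitivity of a tree `x`: the operator `x ▷ ·` is both a derivation
-- and a coderivation, and `x ▷ (X ▷ Y) = (x X) ▷ Y + (x ▷ X) ▷ Y` (`ι_tri_tri`). Therefore the map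
-- defined by `β_{xX} = -β_X α_x - β_{x ▷ X}` is a two-sided convolution inverse of `α`
-- (`beta_eq_recBeta`). Since `x ▷ ·` preserves word length, the sign `(-1)^|X|` turns both minus
-- signs into plus signs (`btr_ι_mul`).
--
-- For nestings, a series of all letters is a series of `x₂, …, xₘ` with `x₁` inserted somewhere.
-- The first step merges `x₁` with its right neighbour, which is either `Y` or one of the `xᵢ`; what
-- remains is a nesting of one letter fewer (`sum_nest_succ`).
--
-- For graftings, `τ₁` sits on a node of `ω` or of another scion. Attaching it there first leaves a
-- grafting of `τ₂, …, τₘ` onto a changed stock, with the same resulting tree. The order convention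
-- fits: having the smallest index, `τ₁` stands directly left of the original children, which is
-- where the first left grafting puts it (`attach_graftAt`, `Contracts.result_eq`,
-- `sum_isGrafting_succ`).

noncomputable section

namespace ForestAlg

variable {k : Type*} [CommRing k]

open Coalgebra FreeAlgebra

/-! ### Words -/

variable (k) in
/-- The ordered forest `τ₁ ⋯ τₘ` as an element of `k{F}`. -/
def word (l : List OTree) : ForestAlg k := (l.map (ι k)).prod

@[simp] lemma word_nil : word k [] = 1 := rfl

@[simp] lemma word_cons (x : OTree) (l : List OTree) : word k (x :: l) = ι k x * word k l := by
  simp [word]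

lemma basis_eq_word (X : FreeMonoid OTree) : basisFreeMonoid k OTree X = word k X.toList := by
  simp [basisFreeMonoid, equivMonoidAlgebraFreeMonoid, word, FreeMonoid.lift_apply]

lemma constr_word {M : Type*} [AddCommGroup M] [Module k M] (f : FreeMonoid OTree → M)
    (l : List OTree) :
    (basisFreeMonoid k OTree).constr k f (word k l) = f (FreeMonoid.ofList l) := by
  have h := (basisFreeMonoid k OTree).constr_basis k f (FreeMonoid.ofList l)
  rwa [basis_eq_word, FreeMonoid.toList_ofList] at h

lemma linearMap_ext_word {M : Type*} [AddCommGroup M] [Module k M] {f g : ForestAlg k →ₗ[k] M}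
    (h : ∀ l, f (word k l) = g (word k l)) : f = g :=
  (basisFreeMonoid k OTree).ext fun X => by rw [basis_eq_word, h]

/-! ### The coproduct -/

lemma comul_ι (x : OTree) :
    comul (R := k) (ι k x) = ι k x ⊗ₜ[k] 1 + 1 ⊗ₜ[k] ι k x := by
  change coshuffle k (ι k x) = _
  simp [coshuffle]

lemma counit_ι (x : OTree) : counit (R := k) (ι k x) = 0 := by
  change eps k (ι k x) = _
  simp [eps]

lemma counit_ι_mul (x : OTree) (X : ForestAlg k) : counit (R := k) (ι k x * X) = 0 := by
  rw [Bialgebra.counit_mul, counit_ι, zero_mul]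

lemma comul_ι_mul (x : OTree) (X : ForestAlg k) :
    comul (R := k) (ι k x * X) =
      (LinearMap.mulLeft k (ι k x)).rTensor _ (comul X) +
        (LinearMap.mulLeft k (ι k x)).lTensor _ (comul X) := by
  rw [Bialgebra.comul_mul, comul_ι, add_mul]
  generalize (comul X : ForestAlg k ⊗[k] ForestAlg k) = t
  congr 1
  · induction t with
    | zero => simp
    | tmul a b => simp
    | add a b ha hb => simp [mul_add, ha, hb]
  · induction t with
    | zero => simp
    | tmul a b => simp
    | add a b ha hb => simp [mul_add, ha, hb]

/-! ### The product `▷` -/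

lemma tri_apply_ι (X : ForestAlg k) (a : OTree) : tri k X (ι k a) = triLetter k a X := by
  simp [tri, triRight]

lemma tri_apply_one (X : ForestAlg k) : tri k X 1 = algebraMap k _ (counit X) := by
  simp [tri]

lemma tri_apply_mul (X Y Z : ForestAlg k) :
    tri k X (Y * Z) =
      LinearMap.mul' k _ (TensorProduct.map ((tri k).flip Y) ((tri k).flip Z) (comul X)) := by
  simp only [tri, LinearMap.flip_apply, LinearMap.comp_apply, AlgHom.toLinearMap_apply, map_mul,
    LinearMap.flip_flip]
  rfl

lemma triLetter_word (a : OTree) (l : List OTree) :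
    triLetter k a (word k l) = letters k (wordTri k l a) := by
  rw [triLetter, constr_word, FreeMonoid.toList_ofList]

lemma letters_single (a : OTree) : letters k (Finsupp.single a 1) = ι k a := by
  simp [letters]

lemma one_tri_ι (a : OTree) : tri k 1 (ι k a) = ι k a := by
  rw [tri_apply_ι, ← word_nil, triLetter_word, wordTri, letters_single]

lemma one_tri (Y : ForestAlg k) : tri k 1 Y = Y := by
  induction Y using FreeAlgebra.induction with
  | grade0 r =>
    rw [Algebra.algebraMap_eq_smul_one, map_smul, tri_apply_one, Bialgebra.counit_one, map_one]
  | grade1 a => exact one_tri_ι a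
  | mul a b ha hb =>
    simp [tri_apply_mul, Bialgebra.comul_one, Algebra.TensorProduct.one_def, ha, hb]
  | add a b ha hb => rw [map_add, ha, hb]

lemma ι_tri_one (x : OTree) : tri k (ι k x) 1 = 0 := by
  rw [tri_apply_one, counit_ι, map_zero]

lemma ι_tri_mul (x : OTree) (Y Z : ForestAlg k) :
    tri k (ι k x) (Y * Z) = tri k (ι k x) Y * Z + Y * tri k (ι k x) Z := by
  simp [tri_apply_mul, comul_ι, one_tri]

lemma ι_tri_letters (x : OTree) (v : OTree →₀ k) :
    tri k (ι k x) (letters k v) = letters k (leftGraft k (Finsupp.single x 1) v) := by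
  have : tri k (ι k x) ∘ₗ letters k = letters k ∘ₗ leftGraft k (Finsupp.single x 1) := by
    ext a
    have h := triLetter_word (k := k) a [x]
    simp only [word_cons, word_nil, mul_one] at h
    simp [letters_single, tri_apply_ι, h, wordTri]
  exact LinearMap.congr_fun this v

lemma ι_tri_ι (x a : OTree) :
    tri k (ι k x) (ι k a) = ∑ s ∈ a.nodes, ι k (OTree.graftAt x s a) := by
  rw [← letters_single a, ι_tri_letters]
  simp [leftGraft, letters_single]

/-- The derivation property spreads `x` over the letters and then over their nodes. This is the
double sum occurring in `wordTri` and `wordBeta`, so their recursions become identities between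
linear maps. -/
lemma ι_tri_word (x : OTree) (l : List OTree) :
    tri k (ι k x) (word k l) =
      ∑ i : Fin l.length, ∑ s ∈ (l.get i).nodes,
        word k (l.set i (OTree.graftAt x s (l.get i))) := by
  induction l with
  | nil => simp [ι_tri_one]
  | cons y l ih =>
    rw [word_cons, ι_tri_mul, ih, ι_tri_ι]
    simp [Fin.sum_univ_succ, Finset.sum_mul, Finset.mul_sum]

lemma counit_ι_tri (x : OTree) (Y : ForestAlg k) : counit (R := k) (tri k (ι k x) Y) = 0 := by
  induction Y using FreeAlgebra.induction with
  | grade0 r => rw [Algebra.algebraMap_eq_smul_one, map_smul, ι_tri_one, smul_zero, map_zero]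
  | grade1 a => simp [ι_tri_ι, counit_ι]
  | mul a b ha hb => simp [ι_tri_mul, Bialgebra.counit_mul, ha, hb]
  | add a b ha hb => simp [ha, hb]

/-- The coderivation property, needed to expand convolution products at `x ▷ X`. It holds on letters
because `x ▷ 1 = 0`, and passes to products by the Leibniz rule. -/
lemma comul_ι_tri (x : OTree) (Y : ForestAlg k) :
    comul (R := k) (tri k (ι k x) Y) =
      (tri k (ι k x)).rTensor _ (comul Y) + (tri k (ι k x)).lTensor _ (comul Y) := by
  induction Y using FreeAlgebra.induction with
  | grade0 r =>
    rw [Algebra.algebraMap_eq_smul_one, map_smul, ι_tri_one, smul_zero, map_zero, map_smul,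
      Bialgebra.comul_one, Algebra.TensorProduct.one_def]
    simp [ι_tri_one]
  | grade1 a =>
    simp [ι_tri_ι, comul_ι, ι_tri_one, Finset.sum_add_distrib, TensorProduct.sum_tmul,
      TensorProduct.tmul_sum]
  | mul a b ha hb =>
    rw [ι_tri_mul, map_add, Bialgebra.comul_mul, Bialgebra.comul_mul, ha, hb, Bialgebra.comul_mul]
    generalize (comul a : ForestAlg k ⊗[k] ForestAlg k) = s
    generalize (comul b : ForestAlg k ⊗[k] ForestAlg k) = t
    induction s with
    | zero => simp
    | tmul p q =>
      induction t with
      | zero => simp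
      | tmul p' q' =>
        simp [ι_tri_mul, add_mul, mul_add, TensorProduct.add_tmul, TensorProduct.tmul_add]
        abel
      | add t t' ht ht' =>
        simp only [mul_add, map_add] at ht ht' ⊢
        convert congrArg₂ (· + ·) ht ht' using 1 <;> abel
    | add s s' hs hs' =>
        simp only [add_mul, map_add] at hs hs' ⊢
        convert congrArg₂ (· + ·) hs hs' using 1 <;> abel
  | add a b ha hb =>
    simp only [map_add, ha, hb]
    abel

lemma triLetter_ι_mul (x a : OTree) (X : ForestAlg k) :
    triLetter k a (ι k x * X) =
      tri k (ι k x) (triLetter k a X) - triLetter k a (tri k (ι k x) X) := by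
  have : triLetter k a ∘ₗ LinearMap.mulLeft k (ι k x) =
      tri k (ι k x) ∘ₗ triLetter k a - triLetter k a ∘ₗ tri k (ι k x) := by
    refine linearMap_ext_word fun l => ?_
    simp only [LinearMap.comp_apply, LinearMap.mulLeft_apply, LinearMap.sub_apply, ← word_cons,
      triLetter_word, ι_tri_word, map_sum, wordTri, map_sub, ι_tri_letters]
  exact LinearMap.congr_fun this X

/-- `x ▷ (X ▷ Y) = (x X) ▷ Y + (x ▷ X) ▷ Y` for a single tree `x`. -/
lemma ι_tri_tri (x : OTree) (Y X : ForestAlg k) :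
    tri k (ι k x) (tri k X Y) = tri k (ι k x * X) Y + tri k (tri k (ι k x) X) Y := by
  induction Y using FreeAlgebra.induction generalizing X with
  | grade0 r =>
    simp only [Algebra.algebraMap_eq_smul_one, map_smul, tri_apply_one, counit_ι_mul, counit_ι_tri,
      counit_ι, smul_zero, zero_smul, add_zero]
  | grade1 a => rw [tri_apply_ι, tri_apply_ι, tri_apply_ι, triLetter_ι_mul]; abel
  | mul a b ha hb =>
    rw [tri_apply_mul, tri_apply_mul, tri_apply_mul, comul_ι_mul, comul_ι_tri]
    generalize (comul X : ForestAlg k ⊗[k] ForestAlg k) = t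
    induction t with
    | zero => simp
    | tmul p q =>
      simp [ι_tri_mul, add_mul, mul_add, ha, hb]
      abel
    | add t t' ht ht' =>
      simp only [map_add] at ht ht' ⊢
      rw [ht, ht']; abel
  | add a b ha hb => simp only [map_add, ha, hb]; abel

/-! ### The convolution inverse of `▷` -/

variable (k) in
/-- The values on words of the convolution inverse of `▷`, by recursion on the first letter. -/
def wordBeta : List OTree → Module.End k (ForestAlg k)
  | [] => 1
  | x :: xs =>
      -(wordBeta xs * tri k (ι k x)) -
        ∑ i : Fin xs.length, ∑ s ∈ (xs.get i).nodes,
          wordBeta (xs.set i (OTree.graftAt x s (xs.get i)))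
termination_by X => X.length
decreasing_by all_goals simp

variable (k) in
/-- The convolution inverse of `▷`, by its recursion on the first letter. -/
def recBeta : ForestAlg k →ₗ[k] Module.End k (ForestAlg k) :=
  (basisFreeMonoid k OTree).constr k fun X => wordBeta k X.toList

lemma recBeta_word (l : List OTree) : recBeta k (word k l) = wordBeta k l := by
  rw [recBeta, constr_word, FreeMonoid.toList_ofList]

lemma recBeta_one : recBeta k 1 = 1 := by
  rw [← word_nil, recBeta_word, wordBeta]

lemma recBeta_ι_mul (x : OTree) (X : ForestAlg k) :
    recBeta k (ι k x * X) =
      -(recBeta k X * tri k (ι k x)) - recBeta k (tri k (ι k x) X) := by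
  have : recBeta k ∘ₗ LinearMap.mulLeft k (ι k x) =
      -(LinearMap.mulRight k (tri k (ι k x)) ∘ₗ recBeta k) - recBeta k ∘ₗ tri k (ι k x) := by
    refine linearMap_ext_word fun l => ?_
    simp only [LinearMap.comp_apply, LinearMap.mulLeft_apply, LinearMap.mulRight_apply,
      LinearMap.sub_apply, LinearMap.neg_apply, ← word_cons,
      recBeta_word, ι_tri_word, map_sum, wordBeta]
  exact LinearMap.congr_fun this X

lemma tri_ι_mul (x : OTree) (X : ForestAlg k) :
    tri k (ι k x * X) = tri k (ι k x) * tri k X - tri k (tri k (ι k x) X) := by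
  ext1 Y
  simp [ι_tri_tri]

lemma tri_one : tri k 1 = 1 := by
  ext1 Y
  simp [one_tri]

/-- An element of the convolution algebra that is `1` on the empty word and whose value on `x X`
is determined, as below, by the values on `X` and on `x ▷ X` is the unit. -/
lemma conv_eq_one {f : WithConv (ForestAlg k →ₗ[k] Module.End k (ForestAlg k))}
    (h1 : f 1 = 1)
    (h : ∀ x l, f (word k l) = algebraMap k _ (counit (word k l)) →
      f (ι k x * word k l) = -f (tri k (ι k x) (word k l))) : f = 1 := by
  have key : ∀ n, ∀ l : List OTree, l.length = n →
      f (word k l) = algebraMap k _ (counit (word k l)) := by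
    intro n
    induction n with
    | zero =>
      intro l hl
      rw [List.length_eq_zero_iff] at hl
      subst hl
      rw [word_nil, h1, Bialgebra.counit_one, map_one]
    | succ n ih =>
      rintro (_ | ⟨x, l⟩) hl
      · simp at hl
      · simp only [List.length_cons, add_left_inj] at hl
        rw [word_cons, h x l (ih l hl), counit_ι_mul, map_zero]
        -- `x ▷ word k l` is a sum of words of the same length as `l`, so by induction `f` acts on
        -- it as the counit, which kills it.
        change -(f.ofConv _) = 0
        have hc := counit_ι_tri x (word k l)
        rw [ι_tri_word] at hc ⊢
        simp only [map_sum] at hc ⊢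
        rw [neg_eq_zero, ← map_zero (algebraMap k (Module.End k (ForestAlg k))), ← hc]
        simp only [map_sum]
        refine Finset.sum_congr rfl fun i _ => Finset.sum_congr rfl fun s _ => ih _ ?_
        simpa using hl
  refine WithConv.ofConv_injective (linearMap_ext_word fun l => key _ l rfl)

/-- One tensor term of `β * α` at `x X`: `t = α_x`, `a` and `c` are the values at the two tensor
factors, `b` and `d` those after applying `x ▷ ·`. The terms `a t c` cancel. -/
lemma ring_cancel_left {R : Type*} [Ring R] (a b c d t : R) :
    (-(a * t) - b) * c + a * (t * c - d) = -(b * c + a * d) := by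
  noncomm_ring

/-- In the order `α * β` nothing cancels outright: the commutator of `t = α_x` with `a c` is left
over. -/
lemma ring_cancel_right {R : Type*} [Ring R] (a b c d t : R) :
    (t * a - b) * c + a * (-(c * t) - d) = -(b * c + a * d) + (t * (a * c) - a * c * t) := by
  noncomm_ring

lemma recBeta_conv_tri : WithConv.toConv (recBeta k) * WithConv.toConv (tri k) = 1 := by
  refine conv_eq_one ?_ fun x l _ => ?_
  · simp [Bialgebra.comul_one, Algebra.TensorProduct.one_def, recBeta_one, tri_one]
  · rw [LinearMap.convMul_apply, LinearMap.convMul_apply, comul_ι_mul, comul_ι_tri]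
    generalize (comul (word k l) : ForestAlg k ⊗[k] ForestAlg k) = t
    induction t with
    | zero => simp
    | tmul p q =>
      simp only [LinearMap.rTensor_tmul, LinearMap.lTensor_tmul, map_add, TensorProduct.map_tmul,
        LinearMap.mul'_apply, LinearMap.mulLeft_apply, recBeta_ι_mul, tri_ι_mul]
      exact ring_cancel_left _ _ _ _ _
    | add t t' ht ht' =>
      simp only [map_add] at ht ht' ⊢
      convert congrArg₂ (· + ·) ht ht' using 1 <;> abel

lemma tri_conv_recBeta : WithConv.toConv (tri k) * WithConv.toConv (recBeta k) = 1 := by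
  refine conv_eq_one ?_ fun x l hl => ?_
  · simp [Bialgebra.comul_one, Algebra.TensorProduct.one_def, recBeta_one, tri_one]
  · have hcomm : tri k (ι k x) *
          (WithConv.toConv (tri k) * WithConv.toConv (recBeta k)) (word k l) =
        (WithConv.toConv (tri k) * WithConv.toConv (recBeta k)) (word k l) * tri k (ι k x) := by
      rw [hl, Algebra.commutes]
    -- The convolution product at the word is a scalar, so its commutator with `α_x` vanishes.
    -- Adding this zero to the goal supplies the leftover of `ring_cancel_right`, after which the
    -- identity can be checked on pure tensors.
    rw [← sub_eq_zero] at hcomm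
    rw [← add_zero (-_), ← hcomm]
    clear hcomm hl
    rw [LinearMap.convMul_apply, LinearMap.convMul_apply, LinearMap.convMul_apply, comul_ι_mul,
      comul_ι_tri]
    generalize (comul (word k l) : ForestAlg k ⊗[k] ForestAlg k) = t
    induction t with
    | zero => simp
    | tmul p q =>
      simp only [LinearMap.rTensor_tmul, LinearMap.lTensor_tmul, map_add, TensorProduct.map_tmul,
        LinearMap.mul'_apply, LinearMap.mulLeft_apply, recBeta_ι_mul, tri_ι_mul]
      exact ring_cancel_right _ _ _ _ _
    | add t t' ht ht' =>
      simp only [map_add, mul_add, add_mul] at ht ht' ⊢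
      convert congrArg₂ (· + ·) ht ht' using 1 <;> abel

lemma beta_eq_recBeta : beta k = recBeta k := by
  rw [beta, Ring.inverse_of_isUnit ⟨⟨_, _, tri_conv_recBeta, recBeta_conv_tri⟩, rfl⟩]
  exact congrArg WithConv.ofConv (Units.inv_eq_of_mul_eq_one_right (by exact tri_conv_recBeta))

/-! ### The product `◀` -/

lemma btr_word (l : List OTree) :
    btr k (word k l) = (-1 : k) ^ l.length • recBeta k (word k l) := by
  rw [btr, constr_word, beta_eq_recBeta, basis_eq_word, FreeMonoid.toList_ofList]
  rfl

lemma btr_one (Y : ForestAlg k) : btr k 1 Y = Y := by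
  rw [← word_nil, btr_word, word_nil, recBeta_one]
  simp

lemma btr_ι_mul (x : OTree) (X Y : ForestAlg k) :
    btr k (ι k x * X) Y = btr k X (tri k (ι k x) Y) + btr k (tri k (ι k x) X) Y := by
  have : btr k ∘ₗ LinearMap.mulLeft k (ι k x) =
      LinearMap.mulRight k (tri k (ι k x)) ∘ₗ btr k + btr k ∘ₗ tri k (ι k x) := by
    refine linearMap_ext_word fun l => ?_
    simp only [LinearMap.comp_apply, LinearMap.mulLeft_apply, LinearMap.mulRight_apply,
      LinearMap.add_apply, ← word_cons, ι_tri_word, map_sum, btr_word, List.length_set]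
    rw [word_cons, recBeta_ι_mul, ι_tri_word]
    simp only [map_sum, List.length_cons, pow_succ, mul_neg, mul_one, smul_sub, smul_neg, neg_smul,
      neg_neg, Finset.smul_sum, Finset.sum_neg_distrib, sub_neg_eq_add, smul_mul_assoc]
  exact LinearMap.congr_fun (LinearMap.congr_fun this X) Y

/-- `(x X) ◀ Y = X ◀ (x ▷ Y) + (x ▷ X) ◀ Y` for a linear combination `x` of trees. -/
lemma btr_letters_mul (v : OTree →₀ k) (X Y : ForestAlg k) :
    btr k (letters k v * X) Y =
      btr k X (tri k (letters k v) Y) + btr k (tri k (letters k v) X) Y := by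
  induction v using Finsupp.induction_linear with
  | zero => simp
  | add f g hf hg =>
    simp only [map_add, add_mul, LinearMap.add_apply, hf, hg]
    abel
  | single a r =>
    have h : Finsupp.single a r = r • Finsupp.single a (1 : k) := by simp
    rw [h, map_smul, letters_single]
    simp [btr_ι_mul]

end ForestAlg

end

-- The recursion for `◀` on products of linear combinations of trees

noncomputable section

namespace ForestAlg

variable {k : Type*} [CommRing k]

open FreeAlgebra

lemma letters_induction {p : ForestAlg k → Prop} (hι : ∀ a, p (ι k a)) (h0 : p 0)
    (hadd : ∀ x y, p x → p y → p (x + y)) (hsmul : ∀ (r : k) x, p x → p (r • x))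
    {x : ForestAlg k} (hx : x ∈ LinearMap.range (letters k)) : p x := by
  obtain ⟨v, rfl⟩ := hx
  induction v using Finsupp.induction_linear with
  | zero => simpa
  | add f g hf hg => rw [map_add]; exact hadd _ _ hf hg
  | single a r =>
    have h : Finsupp.single a r = r • Finsupp.single a (1 : k) := by simp
    rw [h, map_smul, letters_single]
    exact hsmul _ _ (hι a)

lemma ι_mem_range_letters (a : OTree) : ι k a ∈ LinearMap.range (letters k) :=
  ⟨_, letters_single a⟩

/-- Merging two letters gives a linear combination of trees rather than a single tree; this closure
lets the nesting recursion continue. -/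
lemma tri_mem_range_letters {x y : ForestAlg k} (hx : x ∈ LinearMap.range (letters k))
    (hy : y ∈ LinearMap.range (letters k)) : tri k x y ∈ LinearMap.range (letters k) := by
  refine letters_induction (p := fun x => tri k x y ∈ LinearMap.range (letters k))
    (fun a => ?_) (by simp) (fun _ _ h h' => by simpa using add_mem h h')
    (fun r _ h => by simpa using Submodule.smul_mem _ r h) hx
  obtain ⟨v, rfl⟩ := hy
  exact ⟨_, (ι_tri_letters a v).symm⟩

lemma tri_one_of_mem {x : ForestAlg k} (hx : x ∈ LinearMap.range (letters k)) :
    tri k x 1 = 0 :=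
  letters_induction (p := fun x => tri k x 1 = 0) ι_tri_one (by simp)
    (fun _ _ h h' => by simp [h, h']) (fun r _ h => by simp [h]) hx

lemma tri_mul_of_mem {x : ForestAlg k} (hx : x ∈ LinearMap.range (letters k))
    (Y Z : ForestAlg k) : tri k x (Y * Z) = tri k x Y * Z + Y * tri k x Z :=
  letters_induction (p := fun x => tri k x (Y * Z) = tri k x Y * Z + Y * tri k x Z)
    (fun a => ι_tri_mul a Y Z) (by simp)
    (fun _ _ h h' => by simp only [map_add, LinearMap.add_apply, h, h', add_mul, mul_add]; abel)
    (fun r _ h => by simp [h]) hx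

lemma tri_prod_of_mem {x : ForestAlg k} (hx : x ∈ LinearMap.range (letters k)) {m : ℕ}
    (y : Fin m → ForestAlg k) :
    tri k x (List.ofFn y).prod =
      ∑ i, (List.ofFn (Function.update y i (tri k x (y i)))).prod := by
  induction m with
  | zero => simpa using tri_one_of_mem hx
  | succ m ih =>
    rw [List.ofFn_succ, List.prod_cons, tri_mul_of_mem hx, ih, Fin.sum_univ_succ, Finset.mul_sum]
    congr 1
    · simp [List.ofFn_succ]
    · refine Finset.sum_congr rfl fun i _ => ?_
      rw [List.ofFn_succ, List.prod_cons, Function.update_of_ne (Fin.succ_ne_zero i).symm]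
      congr 3
      funext j
      by_cases h : j = i
      · subst h; simp
      · rw [Function.update_of_ne h, Function.update_of_ne (by simpa using h)]

/-- The recursion for `x₁ ⋯ xₘ ◀ Y` that carries out the first nesting step. -/
lemma btr_prod_succ {m : ℕ} {x : Fin (m + 1) → ForestAlg k} (Y : ForestAlg k)
    (hx : ∀ i, x i ∈ LinearMap.range (letters k)) :
    btr k (List.ofFn x).prod Y =
      btr k (List.ofFn fun i : Fin m => x i.succ).prod (tri k (x 0) Y) +
        ∑ i : Fin m, btr k (List.ofFn
          (Function.update (fun i : Fin m => x i.succ) i (tri k (x 0) (x i.succ)))).prod Y := by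
  obtain ⟨v, hv⟩ := hx 0
  rw [List.ofFn_succ, List.prod_cons, ← hv, btr_letters_mul, hv, tri_prod_of_mem (hx 0), map_sum,
    LinearMap.sum_apply]

/-! ### Nestings -/

/-- The series of letters `x_i`, `i` running over the list `l`, followed by `Y`. -/
def series {m : ℕ} (x : Fin m → ForestAlg k) (Y : ForestAlg k) (l : List (Fin m)) :
    List (Finset (Fin m) × ForestAlg k) :=
  l.map (fun i => (({i} : Finset (Fin m)), x i)) ++ [(∅, Y)]

/-- The outcome of all nesting steps on a series. -/
def nestList {m : ℕ} (L : List (Finset (Fin m) × ForestAlg k)) : ForestAlg k :=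
  ((List.finRange m).foldl (fun l j => mergeStep j l) L).headD (∅, 0) |>.2

lemma nest_eq {m : ℕ} (x : Fin m → ForestAlg k) (Y : ForestAlg k) (w : Equiv.Perm (Fin m)) :
    nest x Y w = nestList (series x Y (List.ofFn w)) := by
  simp [nest, nestList, series, List.map_ofFn, Function.comp_def]

/-- Forgetting the index `0` in the index sets. -/
def dropZero {m : ℕ} (e : Finset (Fin (m + 1)) × ForestAlg k) : Finset (Fin m) × ForestAlg k :=
  (e.1.preimage Fin.succ (Fin.succ_injective m).injOn, e.2)

/-- A merge at `j.succ` only tests membership of `j.succ`, so the label `0` is irrelevant to it.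
Hence, once step `0` is done, the remaining steps form a nesting with indices in `Fin m`. -/
lemma dropZero_mergeStep {m : ℕ} (j : Fin m) (L : List (Finset (Fin (m + 1)) × ForestAlg k)) :
    (mergeStep j.succ L).map dropZero = mergeStep j (L.map dropZero) := by
  induction L with
  | nil => rfl
  | cons e L ih =>
    rcases L with _ | ⟨e', L⟩
    · rfl
    · simp only [mergeStep, List.map_cons, dropZero, Finset.mem_preimage]
      split_ifs with h
      · simp [dropZero]
      · rw [List.map_cons, ih]
        simp [dropZero]

lemma nestList_succ {m : ℕ} (L : List (Finset (Fin (m + 1)) × ForestAlg k)) :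
    nestList L = nestList ((mergeStep 0 L).map dropZero) := by
  have key : ∀ (J : List (Fin m)) (L : List (Finset (Fin (m + 1)) × ForestAlg k)),
      ((J.map Fin.succ).foldl (fun l j => mergeStep j l) L).map dropZero =
        J.foldl (fun l j => mergeStep j l) (L.map dropZero) := by
    intro J
    induction J with
    | nil => intro L; rfl
    | cons j J ih => intro L; simp [ih, dropZero_mergeStep]
  rw [nestList, nestList, ← key, List.finRange_succ, List.foldl_cons]
  cases (List.map Fin.succ (List.finRange m)).foldl (fun l j => mergeStep j l) (mergeStep 0 L) <;>
    simp [dropZero]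

lemma series_congr {m : ℕ} {x x' : Fin m → ForestAlg k} (Y : ForestAlg k) {l : List (Fin m)}
    (h : ∀ i ∈ l, x i = x' i) : series x Y l = series x' Y l := by
  simp only [series, List.append_cancel_right_eq]
  exact List.map_congr_left fun i hi => by rw [h i hi]

/-- The first nesting step on all series obtained by inserting `x₀` into a given one. -/
lemma sum_mergeStep_insertions {m : ℕ} (x : Fin (m + 1) → ForestAlg k) (Y : ForestAlg k)
    {l : List (Fin m)} (hl : l.Nodup) (F : List (Finset (Fin m) × ForestAlg k) → ForestAlg k) :
    ((List.permutations'Aux 0 (l.map Fin.succ)).map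
        fun L => F ((mergeStep 0 (series x Y L)).map dropZero)).sum =
      F (series (fun i => x i.succ) (tri k (x 0) Y) l) +
        (l.map fun b => F (series
          (Function.update (fun i => x i.succ) b (tri k (x 0) (x b.succ))) Y l)).sum := by
  have hsucc : ∀ b : Fin m, Finset.preimage ({b.succ} : Finset (Fin (m + 1))) Fin.succ
      (Fin.succ_injective m).injOn = {b} := by
    intro b; ext; simp
  have hsucc' : ∀ b : Fin m, Finset.preimage ({0, b.succ} : Finset (Fin (m + 1))) Fin.succ
      (Fin.succ_injective m).injOn = {b} := by
    intro b; ext; simp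
  have hzero : Finset.preimage ({0} : Finset (Fin (m + 1))) Fin.succ
      (Fin.succ_injective m).injOn = ∅ := by
    ext; simp
  have hmap : ∀ l : List (Fin m), (series x Y (l.map Fin.succ)).map dropZero =
      series (fun i => x i.succ) Y l := by
    intro l
    simp [series, dropZero, hsucc, Function.comp_def]
  have hcons : ∀ (z : Fin m → ForestAlg k) (Z : ForestAlg k) (b : Fin m) (l : List (Fin m)),
      series z Z (b :: l) = ({b}, z b) :: series z Z l := fun _ _ _ _ => rfl
  induction l generalizing F with
  | nil =>
    simp [series, mergeStep, dropZero, hzero]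
  | cons b l ih =>
    rw [List.nodup_cons] at hl
    -- If `0` is inserted behind `b`, step `0` leaves the head entry untouched, so that entry can be
    -- absorbed into `F`.
    have ih := ih hl.2 fun L => F (({b}, x b.succ) :: L)
    have hL : ∀ L ∈ List.permutations'Aux 0 (l.map Fin.succ),
        (mergeStep 0 (series x Y (b.succ :: L))).map dropZero =
          ({b}, x b.succ) :: (mergeStep 0 (series x Y L)).map dropZero := by
      intro L _
      rcases h : series x Y L with _ | ⟨e, L'⟩
      · simp [series] at h
      · have : series x Y (b.succ :: L) = ({b.succ}, x b.succ) :: e :: L' := by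
          rw [← h]; rfl
        rw [this]
        simp [mergeStep, dropZero, hsucc, (Fin.succ_ne_zero b).symm]
    have hb : (mergeStep 0 (series x Y (0 :: b.succ :: l.map Fin.succ))).map dropZero =
        series (Function.update (fun i => x i.succ) b (tri k (x 0) (x b.succ))) Y (b :: l) := by
      have h1 : series x Y (0 :: b.succ :: l.map Fin.succ) =
        ({0}, x 0) :: ({b.succ}, x b.succ) :: series x Y (l.map Fin.succ) := rfl
      rw [h1, hcons, series_congr (x' := fun i => x i.succ)]
      · simp [mergeStep, hmap, dropZero, hsucc']
      · intro i hi
        exact Function.update_of_ne (ne_of_mem_of_not_mem hi hl.1) _ _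
    simp only [List.map_cons, List.permutations'Aux, List.map_map, List.sum_cons,
      Function.comp_def, hb]
    rw [List.map_congr_left fun L hL' => congrArg F (hL L hL'), ih, hcons, add_left_comm]
    congr 3
    refine List.map_congr_left fun c hc => ?_
    rw [hcons, Function.update_of_ne (ne_of_mem_of_not_mem hc hl.1).symm]

/-- A sum over permutations as a sum over rearrangements of the list of all indices. -/
lemma sum_perm_eq_sum_permutations {M : Type*} [AddCommMonoid M] {m : ℕ}
    (F : List (Fin m) → M) :
    ∑ w : Equiv.Perm (Fin m), F (List.ofFn w) =
      ((List.finRange m).permutations'.map F).sum := by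
  classical
  have hnd : (List.finRange m).permutations'.Nodup :=
    (List.permutations_perm_permutations' _).nodup_iff.1
      (List.nodup_permutations _ (List.nodup_finRange m))
  rw [← List.sum_toFinset F hnd]
  refine Finset.sum_bij (fun w _ => List.ofFn w) (fun w _ => ?_) (fun w _ w' _ h => ?_)
    (fun l hl => ?_) (fun _ _ => rfl)
  · rw [List.mem_toFinset, List.mem_permutations', List.ofFn_eq_map]
    exact w.map_finRange_perm
  · exact Equiv.coe_fn_injective (List.ofFn_injective h)
  · rw [List.mem_toFinset, List.mem_permutations'] at hl
    have hlen : l.length = m := by simpa using hl.length_eq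
    have hnd := hl.nodup_iff.2 (List.nodup_finRange _)
    have hinj : Function.Injective fun i : Fin m => l.get (i.cast hlen.symm) :=
      (List.nodup_iff_injective_get.1 hnd).comp (Fin.cast_injective _)
    exact ⟨Equiv.ofBijective _ (Finite.injective_iff_bijective.1 hinj), Finset.mem_univ _,
      List.ext_getElem (by simp [hlen]) (by simp)⟩

/-- The recursion for the sum of all nestings that carries out the first step. -/
lemma sum_nest_succ {m : ℕ} (x : Fin (m + 1) → ForestAlg k) (Y : ForestAlg k) :
    ∑ w, nest x Y w =
      ∑ w, nest (fun i : Fin m => x i.succ) (tri k (x 0) Y) w +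
        ∑ i : Fin m, ∑ w,
          nest (Function.update (fun i : Fin m => x i.succ) i (tri k (x 0) (x i.succ))) Y w := by
  simp only [nest_eq]
  rw [Finset.sum_comm, ← Finset.sum_add_distrib]
  have hR := sum_perm_eq_sum_permutations (m := m) fun l =>
    nestList (series (fun i : Fin m => x i.succ) (tri k (x 0) Y) l) +
      ∑ i : Fin m, nestList (series (Function.update (fun i : Fin m => x i.succ) i
        (tri k (x 0) (x i.succ))) Y l)
  -- `permutations'` of a list with head `0` inserts `0` in every position of every rearrangement of
  -- the tail; the sum is grouped by these rearrangements.
  rw [hR, sum_perm_eq_sum_permutations fun l => nestList (series x Y l), List.finRange_succ,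
    List.permutations', ← List.map_permutations', List.flatMap_map, List.map_flatMap,
    List.flatMap, List.sum_flatten, List.map_map]
  congr 1
  refine List.map_congr_left fun l hl => ?_
  rw [List.mem_permutations'] at hl
  have hnd := hl.nodup_iff.2 (List.nodup_finRange _)
  simp only [Function.comp_apply, nestList_succ (m := m)]
  rw [sum_mergeStep_insertions x Y hnd nestList]
  congr 1
  rw [← List.sum_toFinset _ hnd]
  refine Finset.sum_congr ?_ fun _ _ => rfl
  ext i
  simp [hl.mem_iff]

/-- The nesting formula for `◀`, for linear combinations of trees `xᵢ`. -/
theorem btr_eq_sum_nest {m : ℕ} (x : Fin m → ForestAlg k) (Y : ForestAlg k)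
    (hx : ∀ i, x i ∈ LinearMap.range (letters k)) :
    btr k (List.ofFn x).prod Y = ∑ w, nest x Y w := by
  induction m generalizing Y with
  | zero => simp [btr_one, nest]
  | succ m ih =>
    rw [btr_prod_succ Y hx, sum_nest_succ, ih _ _ fun i => hx i.succ]
    congr 1
    refine Finset.sum_congr rfl fun i _ => ih _ _ fun j => ?_
    by_cases h : j = i
    · subst h
      rw [Function.update_self]
      exact tri_mem_range_letters (hx 0) (hx _)
    · rw [Function.update_of_ne h]
      exact hx _

end ForestAlg

end

namespace OTree

/-! ### Attaching trees -/

lemma attachFrom_eq_mapIdx (g : List ℕ → List OTree) (n : ℕ) (cs : List OTree) :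
    attachFrom g n cs = cs.mapIdx fun i c => attach (fun q => g ((n + i) :: q)) c := by
  induction cs generalizing n with
  | nil => simp [attachFrom]
  | cons c cs ih => simp [attachFrom, ih, add_assoc, add_comm 1]

lemma attach_node (g : List ℕ → List OTree) (cs : List OTree) :
    attach g (node cs) = node (g [] ++ cs.mapIdx fun i c => attach (fun q => g (i :: q)) c) := by
  simp [attach, attachFrom_eq_mapIdx]

mutual

lemma attach_nil : ∀ t : OTree, attach (fun _ => []) t = t
  | node cs => by rw [attach, attachFrom_nil, List.nil_append]

lemma attachFrom_nil : ∀ (n : ℕ) (cs : List OTree), attachFrom (fun _ => []) n cs = cs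
  | _, [] => by rw [attachFrom]
  | n, c :: cs => by rw [attachFrom, attach_nil, attachFrom_nil]

end

lemma graftAt_nil (τ : OTree) (cs : List OTree) : graftAt τ [] (node cs) = node (τ :: cs) := by
  simp only [graftAt, attach_node, reduceCtorEq, if_false, attach_nil, if_true,
    List.singleton_append]
  congr 2
  exact List.ext_getElem? fun i => by simp

lemma graftAt_cons (τ : OTree) (j : ℕ) (s : List ℕ) (cs : List OTree) :
    graftAt τ (j :: s) (node cs) = node (cs.modify j (graftAt τ s)) := by
  simp only [graftAt, attach_node, node.injEq, List.cons.injEq, reduceCtorEq, if_false,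
    List.nil_append]
  refine List.ext_getElem? fun i => ?_
  rw [List.getElem?_mapIdx, List.getElem?_modify]
  by_cases h : i = j
  · subst h; simp; rfl
  · simp [h, Ne.symm h, attach_nil]

/-- The address in `τ ∘ₛ ω` of the node of `ω` with address `q`. -/
def shift : List ℕ → List ℕ → List ℕ
  | [], [] => []
  | [], i :: q => (i + 1) :: q
  | _ :: _, [] => []
  | j :: s, i :: q => i :: if i = j then shift s q else q

/-- Grafting `τ` first and attaching `g` afterwards is one simultaneous attachment to `ω`. At `s`,
`τ` comes last in the list, since later arrivals are placed further left. Before they arrive `τ` is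
child `0` of `s`, hence the addresses `s ++ 0 :: p` for its nodes. -/
lemma attach_graftAt (g : List ℕ → List OTree) (τ : OTree) (s : List ℕ) (ω : OTree) :
    attach g (graftAt τ s ω) =
      attach (fun q => g (shift s q) ++
        if q = s then [attach (fun p => g (s ++ 0 :: p)) τ] else []) ω := by
  induction s generalizing g ω with
  | nil =>
    obtain ⟨cs⟩ := ω
    simp [graftAt_nil, attach_node, shift]
  | cons j s ih =>
    obtain ⟨cs⟩ := ω
    simp only [graftAt_cons, attach_node, shift, List.nil_eq, reduceCtorEq, if_false,
      List.append_nil, node.injEq, List.append_cancel_left_eq]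
    refine List.ext_getElem? fun i => ?_
    rw [List.getElem?_mapIdx, List.getElem?_mapIdx, List.getElem?_modify]
    by_cases h : i = j
    · subst h
      simp only [if_true, Option.map_eq_map, Option.map_map, Function.comp_def, ih, List.cons.injEq,
        true_and, List.cons_append]
    · simp [h, Ne.symm h]

/-! ### The nodes of a grafted tree -/

lemma mem_nodesFrom {n : ℕ} {cs : List OTree} {q : List ℕ} :
    q ∈ nodesFrom n cs ↔ ∃ i c p, cs[i]? = some c ∧ p ∈ nodes c ∧ q = (n + i) :: p := by
  induction cs generalizing n with
  | nil => simp [nodesFrom]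
  | cons c cs ih =>
    simp only [nodesFrom, Finset.mem_union, Finset.mem_image, ih]
    constructor
    · rintro (⟨p, hp, rfl⟩ | ⟨i, c, p, hc, hp, rfl⟩)
      · exact ⟨0, c, p, by simp, hp, rfl⟩
      · exact ⟨i + 1, c, p, by simpa using hc, hp, by congr 1; omega⟩
    · rintro ⟨_ | i, c', p, hc, hp, rfl⟩
      · simp only [List.getElem?_cons_zero, Option.some.injEq] at hc
        subst hc
        exact Or.inl ⟨p, hp, rfl⟩
      · exact Or.inr ⟨i, c', p, by simpa using hc, hp, by congr 1; omega⟩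

lemma nil_mem_nodes (t : OTree) : [] ∈ t.nodes := by
  obtain ⟨cs⟩ := t
  simp [nodes]

lemma cons_mem_nodes {i : ℕ} {p : List ℕ} {cs : List OTree} :
    i :: p ∈ (node cs).nodes ↔ ∃ c, cs[i]? = some c ∧ p ∈ c.nodes := by
  simp only [nodes, Finset.mem_insert, reduceCtorEq, false_or, mem_nodesFrom, zero_add,
    List.cons.injEq]
  constructor
  · rintro ⟨i, c, p, hc, hp, rfl, rfl⟩
    exact ⟨c, hc, hp⟩
  · rintro ⟨c, hc, hp⟩
    exact ⟨i, c, p, hc, hp, rfl, rfl⟩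

lemma mem_nodes_graftAt {τ : OTree} {s : List ℕ} {ω : OTree} (hs : s ∈ ω.nodes) {q : List ℕ} :
    q ∈ (graftAt τ s ω).nodes ↔
      (∃ p ∈ τ.nodes, q = s ++ 0 :: p) ∨ ∃ p ∈ ω.nodes, q = shift s p := by
  induction s generalizing ω q with
  | nil =>
    obtain ⟨cs⟩ := ω
    rw [graftAt_nil]
    constructor
    · intro h
      rcases q with _ | ⟨_ | i, q⟩
      · exact Or.inr ⟨[], nil_mem_nodes _, rfl⟩
      · rw [cons_mem_nodes] at h
        exact Or.inl ⟨q, by simpa using h, rfl⟩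
      · rw [cons_mem_nodes] at h
        exact Or.inr ⟨i :: q, cons_mem_nodes.2 (by simpa using h), rfl⟩
    · rintro (⟨p, hp, rfl⟩ | ⟨_ | ⟨i, p⟩, hp, rfl⟩)
      · exact cons_mem_nodes.2 ⟨τ, rfl, hp⟩
      · exact nil_mem_nodes _
      · rw [shift, cons_mem_nodes]
        simpa using cons_mem_nodes.1 hp
  | cons j s ih =>
    obtain ⟨cs⟩ := ω
    obtain ⟨c, hc, hs'⟩ := cons_mem_nodes.1 hs
    rw [graftAt_cons]
    constructor
    · intro h
      rcases q with _ | ⟨i, q⟩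
      · exact Or.inr ⟨[], nil_mem_nodes _, rfl⟩
      · obtain ⟨c', hc', hq⟩ := cons_mem_nodes.1 h
        rw [List.getElem?_modify] at hc'
        by_cases hij : i = j
        · subst hij
          simp only [hc, if_true, Option.map_eq_map, Option.map_some, Option.some.injEq] at hc'
          subst hc'
          rcases (ih hs').1 hq with ⟨p, hp, rfl⟩ | ⟨p, hp, rfl⟩
          · exact Or.inl ⟨p, hp, rfl⟩
          · exact Or.inr ⟨i :: p, cons_mem_nodes.2 ⟨c, hc, hp⟩, by simp [shift]⟩
        · refine Or.inr ⟨i :: q, cons_mem_nodes.2 ⟨c', ?_, hq⟩, by simp [shift, hij]⟩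
          simpa [Ne.symm hij] using hc'
    · rintro (⟨p, hp, rfl⟩ | ⟨_ | ⟨i, p⟩, hp, rfl⟩)
      · exact cons_mem_nodes.2 ⟨graftAt τ s c, by simp [hc],
          (ih hs').2 (Or.inl ⟨p, hp, rfl⟩)⟩
      · exact nil_mem_nodes _
      · rw [shift, cons_mem_nodes, List.getElem?_modify]
        obtain ⟨c', hc', hp⟩ := cons_mem_nodes.1 hp
        by_cases hij : i = j
        · subst hij
          obtain rfl : c = c' := Option.some_injective _ (hc.symm.trans hc')
          exact ⟨graftAt τ s c, by simp [hc], by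
            simpa using (ih hs').2 (Or.inr ⟨p, hp, rfl⟩)⟩
        · exact ⟨c', by simp [hc', Ne.symm hij], by simpa [hij] using hp⟩

lemma shift_injective (s : List ℕ) : Function.Injective (shift s) := by
  induction s with
  | nil =>
    rintro (_ | ⟨i, p⟩) (_ | ⟨j, q⟩) h <;> simp_all [shift]
  | cons a s ih =>
    rintro (_ | ⟨i, p⟩) (_ | ⟨j, q⟩) h
    · rfl
    · simp [shift] at h
    · simp [shift] at h
    · simp only [shift, List.cons.injEq] at h
      obtain ⟨rfl, h⟩ := h
      split_ifs at h
      · rw [ih h]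
      · rw [h]

lemma shift_ne (s p q : List ℕ) : shift s q ≠ s ++ 0 :: p := by
  induction s generalizing q with
  | nil => rcases q with _ | ⟨i, q⟩ <;> simp [shift]
  | cons a s ih =>
    rcases q with _ | ⟨i, q⟩
    · simp [shift]
    · simp only [shift, List.cons_append, ne_eq, List.cons.injEq, not_and]
      rintro rfl
      simpa using ih q

end OTree

namespace Attachment

open OTree

variable {m : ℕ} {τ : Fin m → OTree} {ω : OTree}

/-! ### Graftings and their results -/

lemma host_none (f : Attachment τ ω) : f.host none = none := rfl

/-- In a grafting, the number of scions below a given one increases by one along every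
attachment, and is at most `m`. -/
lemma IsGrafting.exists_depth {f : Attachment τ ω} (hf : f.IsGrafting) :
    ∃ d : Option (Fin m) → ℕ, (∀ h, d h ≤ m) ∧ ∀ i, d (some i) = d (f i).1 + 1 := by
  classical
  refine ⟨fun h => (Finset.univ.filter fun i => ∃ n, f.host^[n] h = some i).card,
    fun h => (Finset.card_le_univ _).trans (by simp), fun i => ?_⟩
  -- Otherwise `i` would be periodic under `host`, while its orbit must end at the fixed point
  -- `none`.
  have hi : i ∉ Finset.univ.filter fun j => ∃ n, f.host^[n] (f i).1 = some j := by
    simp only [Finset.mem_filter, Finset.mem_univ, true_and, not_exists]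
    intro n hn
    have hp : Function.IsPeriodicPt f.host (n + 1) (some i) := hn
    obtain ⟨N, hN⟩ := hf i
    have h1 := hp.const_mul N
    have h2 : f.host^[N * (n + 1)] (some i) = none := by
      rw [mul_add_one, Function.iterate_add_apply, hN]
      exact Function.iterate_fixed (host_none f) _
    rw [Function.IsPeriodicPt, Function.IsFixedPt, h2] at h1
    exact absurd h1 (by simp)
  beta_reduce
  rw [← Finset.card_insert_of_notMem hi]
  refine congrArg Finset.card ?_
  ext j
  simp only [Finset.mem_filter, Finset.mem_univ, true_and, Finset.mem_insert]
  constructor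
  · rintro ⟨_ | n, hn⟩
    · exact Or.inl (Option.some_injective _ hn).symm
    · exact Or.inr ⟨n, hn⟩
  · rintro (rfl | ⟨n, hn⟩)
    · exact ⟨0, rfl⟩
    · exact ⟨n + 1, hn⟩

/-- Acyclicity expressed by a rank function that drops from a scion to its host; such a rank is easy
to transport when a scion is absorbed. -/
lemma isGrafting_iff {f : Attachment τ ω} :
    f.IsGrafting ↔ ∃ d : Option (Fin m) → ℕ, ∀ i, d (f i).1 < d (some i) := by
  constructor
  · intro hf
    obtain ⟨d, -, hd⟩ := hf.exists_depth
    exact ⟨d, fun i => by rw [hd]; exact Nat.lt_succ_self _⟩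
  · rintro ⟨d, hd⟩
    have key : ∀ n h, d h = n → ∃ n, f.host^[n] h = none := by
      intro n
      induction n using Nat.strong_induction_on with
      | _ n ih =>
        rintro (_ | i) rfl
        · exact ⟨0, rfl⟩
        · obtain ⟨N, hN⟩ := ih _ (hd i) _ rfl
          exact ⟨N + 1, hN⟩
    exact fun i => key _ _ rfl

lemma mem_scionsAt {f : Attachment τ ω} {h : Option (Fin m)} {s : List ℕ} {i : Fin m} :
    i ∈ f.scionsAt h s ↔ (f i).1 = h ∧ (f i).2.1 = s := by
  simp [scionsAt]

lemma scionsAt_eq_nil {f : Attachment τ ω} {d : Option (Fin m) → ℕ} (hdm : ∀ h, d h ≤ m)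
    (hd : ∀ i, d (some i) = d (f i).1 + 1) {h : Option (Fin m)} (hh : m ≤ d h) (s : List ℕ) :
    f.scionsAt h s = [] :=
  List.eq_nil_iff_forall_not_mem.2 fun i hi => by
    have h1 := hd i
    have h2 := hdm (some i)
    rw [(mem_scionsAt.1 hi).1] at h1
    omega

/-- `R h` is, for every `h`, the tree with index `h` with the trees `R (some i)` attached to it, for
the scions `i` that sit on it. -/
def IsAssembled (f : Attachment τ ω) (R : Option (Fin m) → OTree) : Prop :=
  ∀ h, attach (fun s => (f.scionsAt h s).map fun i => R (some i)) (stock τ ω h) = R h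

/-- A tree of depth `d h` carries chains of at most `m - d h` scions, so further rounds of attaching
change nothing. -/
lemma IsGrafting.isAssembled {f : Attachment τ ω} (hf : f.IsGrafting) :
    f.IsAssembled (f.assemble m) := by
  obtain ⟨d, hdm, hd⟩ := hf.exists_depth
  have key : ∀ n h, m ≤ n + d h → f.assemble (n + 1) h = f.assemble n h := by
    intro n
    induction n with
    | zero =>
      intro h hh
      have := scionsAt_eq_nil hdm hd (h := h) (by omega)
      simp only [assemble, this, List.map_nil, attach_nil]
    | succ n ih =>
      intro h hh
      rw [assemble, assemble]
      congr 1
      funext s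
      refine List.map_congr_left fun i hi => ih _ ?_
      rw [hd, (mem_scionsAt.1 hi).1]
      omega
  exact fun h => key m h (Nat.le_add_right _ _)

/-- Fixed points of assembling are unique for a grafting, by induction from the deepest scions
downwards. Results can thus be compared without counting rounds. -/
lemma IsAssembled.eq_result {f : Attachment τ ω} {R : Option (Fin m) → OTree}
    (hR : f.IsAssembled R) (hf : f.IsGrafting) : R none = f.result := by
  obtain ⟨d, hdm, hd⟩ := hf.exists_depth
  have key : ∀ n h, m ≤ n + d h → R h = f.assemble n h := by
    intro n
    induction n with
    | zero =>
      intro h hh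
      have := scionsAt_eq_nil hdm hd (h := h) (by omega)
      rw [← hR h]
      simp only [assemble, this, List.map_nil, attach_nil]
    | succ n ih =>
      intro h hh
      rw [assemble, ← hR h]
      congr 1
      funext s
      refine List.map_congr_left fun i hi => ih _ ?_
      rw [hd, (mem_scionsAt.1 hi).1]
      omega
  exact key m none (Nat.le_add_right _ _)

/-! ### Attaching the first scion -/

/-- The index, after the scion `0` has been attached to the tree `h₁`, of the tree that contains
the tree `h`. -/
def contractIdx (h₁ : Option (Fin m)) : Option (Fin (m + 1)) → Option (Fin m)
  | none => none
  | some i => Fin.cases h₁ some i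

/-- The address, after the scion `0` has been attached to the node `s₀` of the tree `h₁`, of the
node `q` of the tree `h`. -/
def contractAddr (h₁ : Option (Fin m)) (s₀ : List ℕ) (h : Option (Fin (m + 1))) (q : List ℕ) :
    List ℕ :=
  if h = some 0 then s₀ ++ 0 :: q else if contractIdx h₁ h = h₁ then shift s₀ q else q

/-- The index of a tree before the scion `0` has been attached. -/
abbrev expandIdx : Option (Fin m) → Option (Fin (m + 1)) := Option.map Fin.succ

lemma expandIdx_ne (h : Option (Fin m)) : expandIdx h ≠ some 0 := by
  rcases h with _ | i <;> simp [Fin.succ_ne_zero]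

@[simp] lemma contractIdx_expandIdx (h₁ h : Option (Fin m)) :
    contractIdx h₁ (expandIdx h) = h := by
  rcases h with _ | i <;> simp [contractIdx]

@[simp] lemma contractIdx_zero (h₁ : Option (Fin m)) : contractIdx h₁ (some 0) = h₁ := rfl

lemma eq_zero_or_expandIdx (h : Option (Fin (m + 1))) : h = some 0 ∨ ∃ h', h = expandIdx h' := by
  rcases h with _ | i
  · exact Or.inr ⟨none, rfl⟩
  · refine Fin.cases (Or.inl rfl) (fun i => Or.inr ⟨some i, rfl⟩) i

lemma contractAddr_zero (h₁ : Option (Fin m)) (s₀ q : List ℕ) :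
    contractAddr h₁ s₀ (some 0) q = s₀ ++ 0 :: q := by
  simp [contractAddr]

lemma contractAddr_self (h₁ : Option (Fin m)) (s₀ q : List ℕ) :
    contractAddr h₁ s₀ (expandIdx h₁) q = shift s₀ q := by
  rw [contractAddr, if_neg (expandIdx_ne _), if_pos (contractIdx_expandIdx _ _)]

lemma contractAddr_of_ne {h₁ h : Option (Fin m)} (hh : h ≠ h₁) (s₀ q : List ℕ) :
    contractAddr h₁ s₀ (expandIdx h) q = q := by
  rw [contractAddr, if_neg (expandIdx_ne _), if_neg (by rwa [contractIdx_expandIdx])]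

/-- Only the merged tree needs care: its nodes from scion `0` and from the old host have disjoint
addresses by `shift_ne`. -/
lemma contract_inj {h₁ : Option (Fin m)} {s₀ : List ℕ} {h h' : Option (Fin (m + 1))}
    {q q' : List ℕ} :
    (contractIdx h₁ h = contractIdx h₁ h' ∧ contractAddr h₁ s₀ h q = contractAddr h₁ s₀ h' q') ↔
      h = h' ∧ q = q' := by
  refine ⟨?_, by rintro ⟨rfl, rfl⟩; exact ⟨rfl, rfl⟩⟩
  rintro ⟨hi, ha⟩
  rcases eq_zero_or_expandIdx h with rfl | ⟨h, rfl⟩ <;>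
  rcases eq_zero_or_expandIdx h' with rfl | ⟨h', rfl⟩
  · simpa [contractAddr_zero] using ha
  · simp only [contractIdx_zero, contractIdx_expandIdx] at hi
    subst hi
    rw [contractAddr_zero, contractAddr_self] at ha
    exact absurd ha.symm (shift_ne _ _ _)
  · simp only [contractIdx_zero, contractIdx_expandIdx] at hi
    subst hi
    rw [contractAddr_zero, contractAddr_self] at ha
    exact absurd ha (shift_ne _ _ _)
  · simp only [contractIdx_expandIdx] at hi
    subst hi
    by_cases hh : h = h₁
    · subst hh
      rw [contractAddr_self, contractAddr_self] at ha
      exact ⟨rfl, shift_injective _ ha⟩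
    · rw [contractAddr_of_ne hh, contractAddr_of_ne hh] at ha
      exact ⟨rfl, ha⟩

section Contract

variable {τ : Fin (m + 1) → OTree} {ω : OTree} {τ' : Fin m → OTree} {ω' : OTree}
  {h₁ : Option (Fin m)} {s₀ : List ℕ}

/-- The stock `τ'`, `ω'` arises from `τ`, `ω` by attaching the scion `0` to the node `s₀` of the tree
`h₁`. -/
structure StockContracts (τ : Fin (m + 1) → OTree) (ω : OTree) (τ' : Fin m → OTree) (ω' : OTree)
    (h₁ : Option (Fin m)) (s₀ : List ℕ) : Prop where
  mem : s₀ ∈ (stock τ ω (expandIdx h₁)).nodes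
  self : stock τ' ω' h₁ = graftAt (τ 0) s₀ (stock τ ω (expandIdx h₁))
  of_ne : ∀ h, h ≠ h₁ → stock τ' ω' h = stock τ ω (expandIdx h)

/-- The attachment `f'` of the remaining scions arises from `f` by attaching the scion `0`. -/
structure Contracts (f : Attachment τ ω) (f' : Attachment τ' ω') (h₁ : Option (Fin m))
    (s₀ : List ℕ) : Prop where
  host_zero : (f 0).1 = expandIdx h₁
  addr_zero : (f 0).2.1 = s₀
  host_succ : ∀ i, (f' i).1 = contractIdx h₁ (f i.succ).1
  addr_succ : ∀ i, (f' i).2.1 = contractAddr h₁ s₀ (f i.succ).1 (f i.succ).2.1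

variable {f : Attachment τ ω} {f' : Attachment τ' ω'}

lemma Contracts.isGrafting_iff (hc : Contracts f f' h₁ s₀) : f.IsGrafting ↔ f'.IsGrafting := by
  rw [Attachment.isGrafting_iff, Attachment.isGrafting_iff]
  constructor
  · rintro ⟨d, hd⟩
    refine ⟨fun h => d (expandIdx h), fun i => ?_⟩
    rw [hc.host_succ]
    have h1 := hd i.succ
    rcases eq_zero_or_expandIdx (f i.succ).1 with h | ⟨h', h⟩
    · rw [h] at h1 ⊢
      have h0 := hd 0
      rw [hc.host_zero] at h0
      exact h0.trans h1
    · rw [h] at h1 ⊢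
      rwa [contractIdx_expandIdx]
  · rintro ⟨d, hd⟩
    -- Doubling the rank leaves room for scion `0` strictly between its host and the scions that sit
    -- on it.
    refine ⟨fun h => 2 * d (contractIdx h₁ h) + if h = some 0 then 1 else 0, fun i => ?_⟩
    refine Fin.cases ?_ (fun i => ?_) i
    · beta_reduce
      rw [hc.host_zero, if_neg (expandIdx_ne _), contractIdx_expandIdx]
      simp
    · have h1 := hd i
      rw [hc.host_succ] at h1
      have h2 : contractIdx h₁ (some i.succ) = some i := rfl
      beta_reduce
      rw [h2, if_neg (c := some i.succ = some 0) (by simp [Fin.succ_ne_zero])]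
      split_ifs <;> omega

/-- Scion `0` has the smallest index and so ends the list at its node, in agreement with
`attach_graftAt`. -/
lemma Contracts.scionsAt (hc : Contracts f f' h₁ s₀) (h : Option (Fin (m + 1))) (q : List ℕ) :
    f.scionsAt h q =
      (f'.scionsAt (contractIdx h₁ h) (contractAddr h₁ s₀ h q)).map Fin.succ ++
        if h = expandIdx h₁ ∧ q = s₀ then [0] else [] := by
  rw [Attachment.scionsAt, Attachment.scionsAt, List.finRange_succ, List.reverse_cons,
    List.filter_append, ← List.map_reverse, List.filter_map]
  congr 1
  · congr 1
    refine List.filter_congr fun i _ => ?_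
    rw [Function.comp_apply, decide_eq_decide, hc.addr_succ, ← contract_inj (h₁ := h₁) (s₀ := s₀),
      ← hc.host_succ]
  · have hp : ((f 0).1 = h ∧ (f 0).2.1 = q) ↔ h = expandIdx h₁ ∧ q = s₀ :=
      and_congr ((Iff.of_eq (congrArg (· = h) hc.host_zero)).trans eq_comm)
        ((Iff.of_eq (congrArg (· = q) hc.addr_zero)).trans eq_comm)
    rw [List.filter_singleton, decide_eq_decide.2 hp, Bool.cond_decide]

lemma Contracts.result_eq (hc : Contracts f f' h₁ s₀) (hs : StockContracts τ ω τ' ω' h₁ s₀)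
    (hf : f.IsGrafting) : f.result = f'.result := by
  have hR := hf.isAssembled
  set R := f.assemble (m + 1)
  -- The assembled trees of `f` other than that of scion `0` also solve the fixed-point equation for
  -- `f'`, and uniqueness identifies the results.
  have hR' : f'.IsAssembled fun h => R (expandIdx h) := by
    intro h
    beta_reduce
    rw [← hR (expandIdx h)]
    by_cases hh : h = h₁
    · subst hh
      rw [hs.self, attach_graftAt]
      congr 1
      funext q
      rw [hc.scionsAt, contractIdx_expandIdx, contractAddr_self, List.map_append, List.map_map]
      congr 1
      by_cases hq : q = s₀
      · rw [if_pos hq, if_pos ⟨rfl, hq⟩, List.map_singleton, ← hR (some 0)]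
        congr 2
        funext p
        rw [hc.scionsAt, contractAddr_zero, if_neg (by simp [(expandIdx_ne _).symm])]
        simp
      · rw [if_neg hq, if_neg (by simp [hq])]
        rfl
    · rw [hs.of_ne h hh]
      congr 1
      funext q
      rw [hc.scionsAt, contractIdx_expandIdx, contractAddr_of_ne hh, if_neg]
      · simp
      · rintro ⟨h2, -⟩
        exact hh (Option.map_injective (Fin.succ_injective m) h2)
  exact hR'.eq_result (hc.isGrafting_iff.1 hf)

/-- Nodes before and after attaching the scion `0`. -/
lemma StockContracts.contractAddr_mem (hs : StockContracts τ ω τ' ω' h₁ s₀)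
    {h : Option (Fin (m + 1))} {q : List ℕ} (hq : q ∈ (stock τ ω h).nodes) :
    contractAddr h₁ s₀ h q ∈ (stock τ' ω' (contractIdx h₁ h)).nodes := by
  rcases eq_zero_or_expandIdx h with rfl | ⟨h, rfl⟩
  · rw [contractAddr_zero, contractIdx_zero, hs.self, mem_nodes_graftAt hs.mem]
    exact Or.inl ⟨q, hq, rfl⟩
  · rw [contractIdx_expandIdx]
    by_cases hh : h = h₁
    · subst hh
      rw [contractAddr_self, hs.self, mem_nodes_graftAt hs.mem]
      exact Or.inr ⟨q, hq, rfl⟩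
    · rwa [contractAddr_of_ne hh, hs.of_ne h hh]

lemma pos_ext {p p' : (h : Option (Fin m)) × {s : List ℕ // s ∈ (stock τ' ω' h).nodes}}
    (h1 : p.1 = p'.1) (h2 : p.2.1 = p'.2.1) : p = p' := by
  obtain ⟨h, s, hs⟩ := p
  obtain ⟨h', s', hs'⟩ := p'
  obtain rfl : h = h' := h1
  obtain rfl : s = s' := h2
  rfl

/-- The bijection between the nodes before and after attaching the scion `0`. -/
noncomputable def StockContracts.posEquiv (hs : StockContracts τ ω τ' ω' h₁ s₀) :
    ((h : Option (Fin (m + 1))) × {s : List ℕ // s ∈ (stock τ ω h).nodes}) ≃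
      ((h : Option (Fin m)) × {s : List ℕ // s ∈ (stock τ' ω' h).nodes}) :=
  Equiv.ofBijective
    (fun p => ⟨contractIdx h₁ p.1, contractAddr h₁ s₀ p.1 p.2.1, hs.contractAddr_mem p.2.2⟩) <| by
    constructor
    · intro p p' hp
      have h := contract_inj.1 ⟨congrArg (fun p => p.1) hp, congrArg (fun p => p.2.1) hp⟩
      exact pos_ext h.1 h.2
    · rintro ⟨h, q, hq⟩
      by_cases hh : h = h₁
      · subst hh
        have hq' := hq
        rw [hs.self, mem_nodes_graftAt hs.mem] at hq'
        rcases hq' with ⟨p, hp, rfl⟩ | ⟨p, hp, rfl⟩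
        · exact ⟨⟨some 0, p, hp⟩, pos_ext rfl (contractAddr_zero h _ _)⟩
        · exact ⟨⟨expandIdx h, p, hp⟩, pos_ext (contractIdx_expandIdx _ _)
            (contractAddr_self _ _ _)⟩
      · exact ⟨⟨expandIdx h, q, by rwa [← hs.of_ne h hh]⟩, pos_ext (contractIdx_expandIdx _ _)
            (contractAddr_of_ne hh _ _)⟩

open Classical in
/-- The sum over all graftings in which the scion `0` sits on a given node is the sum over all
graftings of the other scions after it has been attached there. -/
lemma StockContracts.sum_eq {M : Type*} [AddCommMonoid M] (F : OTree → M)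
    (hs : StockContracts τ ω τ' ω' h₁ s₀) :
    ∑ g : Fin m → (h : Option (Fin (m + 1))) × {s : List ℕ // s ∈ (stock τ ω h).nodes},
      (if IsGrafting (τ := τ) (ω := ω) (Fin.cons ⟨expandIdx h₁, s₀, hs.mem⟩ g) then
        F (result (τ := τ) (ω := ω) (Fin.cons ⟨expandIdx h₁, s₀, hs.mem⟩ g)) else 0) =
      ∑ f : Attachment τ' ω', if f.IsGrafting then F f.result else 0 := by
  refine Fintype.sum_equiv (Equiv.arrowCongr (Equiv.refl _) hs.posEquiv) _ _ fun g => ?_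
  have hc : Contracts (τ := τ) (ω := ω) (τ' := τ') (ω' := ω')
      (Fin.cons ⟨expandIdx h₁, s₀, hs.mem⟩ g)
      (Equiv.arrowCongr (Equiv.refl _) hs.posEquiv g) h₁ s₀ :=
    ⟨rfl, rfl, fun _ => rfl, fun _ => rfl⟩
  by_cases hf : IsGrafting (τ := τ) (ω := ω) (Fin.cons ⟨expandIdx h₁, s₀, hs.mem⟩ g)
  · rw [if_pos hf, if_pos (hc.isGrafting_iff.1 hf), hc.result_eq hs hf]
  · rw [if_neg hf, if_neg (mt hc.isGrafting_iff.2 hf)]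

end Contract

lemma stockContracts_none (τ : Fin (m + 1) → OTree) (ω : OTree) {s : List ℕ} (hs : s ∈ ω.nodes) :
    StockContracts τ ω (fun i => τ i.succ) (graftAt (τ 0) s ω) none s where
  mem := hs
  self := rfl
  of_ne h hh := by
    rcases h with _ | i
    · exact absurd rfl hh
    · rfl

lemma stockContracts_some (τ : Fin (m + 1) → OTree) (ω : OTree) {s : List ℕ} (i : Fin m)
    (hs : s ∈ (τ i.succ).nodes) :
    StockContracts τ ω (Function.update (fun i => τ i.succ) i (graftAt (τ 0) s (τ i.succ))) ω
      (some i) s where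
  mem := hs
  self := by simp [stock]
  of_ne h hh := by
    rcases h with _ | j
    · rfl
    · simp only [stock, Option.map_some]
      rw [Function.update_of_ne (by simpa using hh)]

open Classical in
/-- The recursion for the sum over all graftings that attaches the first scion. -/
lemma sum_isGrafting_succ {M : Type*} [AddCommMonoid M] (F : OTree → M)
    (τ : Fin (m + 1) → OTree) (ω : OTree) :
    ∑ f : Attachment τ ω with f.IsGrafting, F f.result =
      ∑ s ∈ ω.nodes, ∑ f : Attachment (fun i => τ i.succ) (graftAt (τ 0) s ω) with f.IsGrafting,
        F f.result +
      ∑ i : Fin m, ∑ s ∈ (τ i.succ).nodes, ∑ f : Attachment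
        (Function.update (fun i => τ i.succ) i (graftAt (τ 0) s (τ i.succ))) ω with f.IsGrafting,
        F f.result := by
  simp only [Finset.sum_filter]
  -- The position of scion `0` is separated from the others, then split by its host: the rootstock,
  -- scion `0` itself (contributing zero), or another scion.
  rw [← Equiv.sum_comp (Fin.consEquiv fun _ : Fin (m + 1) =>
      (h : Option (Fin (m + 1))) × {s : List ℕ // s ∈ (stock τ ω h).nodes}),
    Fintype.sum_prod_type, Fintype.sum_sigma, Fintype.sum_option, Fin.sum_univ_succ]
  rw [Finset.sum_eq_zero (s := Finset.univ) (ι := {s : List ℕ // s ∈ (stock τ ω (some 0)).nodes}),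
    zero_add]
  · congr 1
    · rw [← Finset.sum_coe_sort ω.nodes]
      exact Finset.sum_congr rfl fun s _ => (stockContracts_none τ ω s.2).sum_eq F
    · refine Finset.sum_congr rfl fun i _ => ?_
      rw [← Finset.sum_coe_sort (τ i.succ).nodes]
      exact Finset.sum_congr rfl fun s _ => (stockContracts_some τ ω i s.2).sum_eq F
  · intro s _
    refine Finset.sum_eq_zero fun g _ => if_neg fun hf => ?_
    obtain ⟨d, hd⟩ := isGrafting_iff.1 hf
    exact lt_irrefl _ (hd 0)

end Attachment

-- The grafting formula and the theorem

namespace ForestAlg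

variable {k : Type*} [CommRing k]

open FreeAlgebra

/-- Multilinearity of the product expands a letter `τ₀ ▷ τᵢ` into single trees, to which the
induction hypothesis applies. -/
lemma prod_ofFn_update_sum {m : ℕ} {α : Type*} (y : Fin m → ForestAlg k) (i : Fin m)
    (t : Finset α) (z : α → ForestAlg k) :
    (List.ofFn (Function.update y i (∑ a ∈ t, z a))).prod =
      ∑ a ∈ t, (List.ofFn (Function.update y i (z a))).prod := by
  simpa only [MultilinearMap.mkPiAlgebraFin_apply] using
    (MultilinearMap.mkPiAlgebraFin k m (ForestAlg k)).map_update_sum t i z y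

open Classical in
/-- The grafting formula for `◀`. -/
theorem btr_eq_sum_graftings {m : ℕ} (τ : Fin m → OTree) (ω : OTree) :
    btr k (List.ofFn fun i => ι k (τ i)).prod (ι k ω) =
      ∑ f : Attachment τ ω with f.IsGrafting, ι k f.result := by
  induction m generalizing ω with
  | zero =>
    rw [Finset.filter_true_of_mem fun f _ i => i.elim0, Fintype.sum_unique]
    simp [btr_one, Attachment.result, Attachment.assemble, stock]
  | succ m ih =>
    rw [btr_prod_succ _ fun i => ι_mem_range_letters _, Attachment.sum_isGrafting_succ]
    congr 1
    · rw [ι_tri_ι, map_sum]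
      exact Finset.sum_congr rfl fun s _ => ih _ _
    · refine Finset.sum_congr rfl fun i _ => ?_
      rw [ι_tri_ι, prod_ofFn_update_sum, map_sum, LinearMap.sum_apply]
      refine Finset.sum_congr rfl fun s _ => ?_
      rw [← ih]
      congr 4
      funext j
      exact (Function.apply_update (fun _ => ι k) _ i _ j).symm

end ForestAlg

open Classical in
theorem mainTheorem9 (k : Type*) [Field k] [IsAlgClosed k] [CharZero k]
    {m : ℕ} (τ : Fin m → OTree) (ω : OTree) :
    ForestAlg.btr k (List.ofFn fun i => FreeAlgebra.ι k (τ i)).prod (FreeAlgebra.ι k ω) =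
        ∑ w : Equiv.Perm (Fin m),
          ForestAlg.nest (fun i => FreeAlgebra.ι k (τ i)) (FreeAlgebra.ι k ω) w ∧
      ForestAlg.btr k (List.ofFn fun i => FreeAlgebra.ι k (τ i)).prod (FreeAlgebra.ι k ω) =
        ∑ f : Attachment τ ω with f.IsGrafting, FreeAlgebra.ι k f.result :=
  ⟨ForestAlg.btr_eq_sum_nest _ _ fun i => ForestAlg.ι_mem_range_letters (τ i),
    ForestAlg.btr_eq_sum_graftings τ ω⟩
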